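/- For every positive integer $w$ there is a constant $c = c(w) > 0$ such that for every $n \ge 1$, every branching program of width at most $w$ that computes the majority function $\mathrm{Maj}_n$ has length at least $c\, n \log n$; that is, any bounded-width branching program computing $\mathrm{Maj}_n$ has length $\Omega(n \log n)$. Here $\mathrm{Maj}_n : \{0,1\}^n \to \{0,1\}$ is defined by $\mathrm{Maj}_n(x) = 1$ if $x$ has at least $n/2$ ones, and $\mathrm{Maj}_n(x) = 0$ otherwise. A branching program of length $L$ and width at most $w$ on the variables $x_1, \dots, x_n$ has levels $0, 1, \dots, L$, each with at most $w$ vertices, and a start vertex in level $0$. Every vertex in a level $t < L$ is labelled with a variable (vertices of the same level may be labelled with different variables) and has two outgoing edges to level $t+1$, labelled $0$ and $1$; every vertex of level $L$ is labelled with an output in $\{0,1\}$. On an input $x$ the program follows, from the start vertex, at each vertex the edge labelled with the value of the variable queried there, and outputs the label of the vertex it reaches in level $L$. -/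

import Mathlib

/-- The Hamming weight `|x|`: the number of ones of `x ∈ {0,1}ⁿ`. -/
def hammingWeight {n : ℕ} (x : Fin n → Bool) : ℕ :=
  (Finset.univ.filter (fun i => x i = true)).card

/-- The majority function: `maj n x = 1` if and only if `|x| ≥ n / 2`
(a division of rational numbers, so without rounding). -/
def maj (n : ℕ) (x : Fin n → Bool) : Bool :=
  decide ((n : ℚ) / 2 ≤ (hammingWeight x : ℚ))

/-- A (deterministic, levelled) branching program over the variables `x₀, …, xₙ₋₁`.
Its vertices are arranged in the levels `0, …, length`, each with (at most) `width` vertices: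
vertices that cannot be reached do no harm, so every level is indexed by `Fin width`.
Every vertex `v` of a level `t < length` is labelled with the variable `query t v`, and has two
outgoing edges, labelled `0` and `1`, to the vertices `next t v false` and `next t v true` of
the level `t + 1`. Vertices of the same level may query different variables.
The vertices of the last level are sinks, labelled with an output. -/
structure BranchingProgram (n : ℕ) where
  width : ℕ
  length : ℕ
  start : Fin width
  query : Fin length → Fin width → Fin n
  next : Fin length → Fin width → Bool → Fin width
  output : Fin width → Bool

namespace BranchingProgram

/-- The vertex of level `t` that the computation on the input `x` reaches
(for `t ≤ P.length`; there are no further levels, and nothing happens after the last one). -/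
def state {n : ℕ} (P : BranchingProgram n) (x : Fin n → Bool) : ℕ → Fin P.width
  | 0 => P.start
  | t + 1 =>
    if h : t < P.length then
      P.next ⟨t, h⟩ (P.state x t) (x (P.query ⟨t, h⟩ (P.state x t)))
    else P.state x t

/-- The output of the branching program on the input `x`. -/
def eval {n : ℕ} (P : BranchingProgram n) (x : Fin n → Bool) : Bool :=
  P.output (P.state x P.length)

/-- The branching program `P` computes the boolean function `f`. -/
def Computes {n : ℕ} (P : BranchingProgram n) (f : (Fin n → Bool) → Bool) : Prop :=
  ∀ x : Fin n → Bool, P.eval x = f x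

end BranchingProgram

/-! Let `k` be about `2 * width * length / n`. By Markov, more than half of the variables are
queried in at most `k` levels. Halve this set; the meander lemma `exists_alternates` finds in the
halves sets `S` and `T` of size `m = width ^ (2k + 1)` such that the levels split into `2k + 1`
blocks, each avoiding `S` or `T`. The program is then a short protocol between the holders of `S`
and `T`, each block transmitting one of `width` states. Majority defeats it when `n` is large: the
inputs with `i` ones in `S`, `m - i` in `T` and total weight `⌈n/2⌉` form a fooling set of size `m +
1`. Hence `n < (8 * width ^ 2) ^ (k + 1)`, that is, `log n = O(length / n)` for bounded width. -/

namespace BranchingProgram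

variable {n : ℕ}

/-! ### Queried variables and their multiplicities -/

/-- The set of variables queried by the vertices of level `t`. -/
def queried (P : BranchingProgram n) (t : Fin P.length) : Finset (Fin n) :=
  Finset.univ.image (P.query t)

theorem card_queried_le (P : BranchingProgram n) (t : Fin P.length) :
    (P.queried t).card ≤ P.width :=
  Finset.card_image_le.trans (by simp)

/-- The set of variables queried in the levels `s, …, e - 1`. -/
def queriedBetween (P : BranchingProgram n) (s e : ℕ) : Finset (Fin n) :=
  (Finset.univ.filter (fun t : Fin P.length => s ≤ t ∧ (t : ℕ) < e)).biUnion P.queried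

/-- The number of levels from `s` on in which the variable `v` is queried. -/
def multiplicity (P : BranchingProgram n) (s : ℕ) (v : Fin n) : ℕ :=
  (Finset.univ.filter (fun t : Fin P.length => s ≤ t ∧ v ∈ P.queried t)).card

theorem mem_queriedBetween {P : BranchingProgram n} {s e : ℕ} {v : Fin n} :
    v ∈ P.queriedBetween s e ↔
      ∃ t : Fin P.length, (s ≤ t ∧ (t : ℕ) < e) ∧ v ∈ P.queried t := by
  simp [queriedBetween]

theorem queriedBetween_self (P : BranchingProgram n) (s : ℕ) : P.queriedBetween s s = ∅ := by
  ext v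
  simp only [mem_queriedBetween, Finset.notMem_empty, iff_false]
  rintro ⟨t, h, -⟩
  omega

theorem card_queriedBetween_succ_inter_le (P : BranchingProgram n) (s e : ℕ)
    (B : Finset (Fin n)) :
    (B ∩ P.queriedBetween s (e + 1)).card ≤ (B ∩ P.queriedBetween s e).card + P.width := by
  by_cases he : e < P.length
  · have hsub : B ∩ P.queriedBetween s (e + 1) ⊆
        (B ∩ P.queriedBetween s e) ∪ P.queried ⟨e, he⟩ := by
      intro v hv
      obtain ⟨hB, hv⟩ := Finset.mem_inter.1 hv
      obtain ⟨t, ht, hvt⟩ := mem_queriedBetween.1 hv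
      rw [Finset.mem_union, Finset.mem_inter]
      by_cases hte : (t : ℕ) < e
      · exact Or.inl ⟨hB, mem_queriedBetween.2 ⟨t, ⟨ht.1, hte⟩, hvt⟩⟩
      · obtain rfl : t = ⟨e, he⟩ := Fin.ext (by simp only; omega)
        exact Or.inr hvt
    exact (Finset.card_le_card hsub).trans
      ((Finset.card_union_le _ _).trans (Nat.add_le_add_left (P.card_queried_le _) _))
  · have hsub : B ∩ P.queriedBetween s (e + 1) ⊆ B ∩ P.queriedBetween s e := by
      refine Finset.inter_subset_inter_left fun v hv => ?_
      obtain ⟨t, ht, hvt⟩ := mem_queriedBetween.1 hv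
      exact mem_queriedBetween.2 ⟨t, ⟨ht.1, by omega⟩, hvt⟩
    exact (Finset.card_le_card hsub).trans (Nat.le_add_right _ _)

/-- This drop in multiplicity drives the induction of the meander lemma. -/
theorem multiplicity_lt_of_mem {P : BranchingProgram n} {s e : ℕ} (hse : s ≤ e) {v : Fin n}
    (hv : v ∈ P.queriedBetween s e) : P.multiplicity e v < P.multiplicity s v := by
  obtain ⟨t, ht, hvt⟩ := mem_queriedBetween.1 hv
  refine Finset.card_lt_card (Finset.ssubset_iff_of_subset ?_ |>.2 ⟨t, ?_, ?_⟩)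
  · intro u hu
    simp only [Finset.mem_filter, Finset.mem_univ, true_and] at hu ⊢
    exact ⟨hse.trans hu.1, hu.2⟩
  · simpa using ⟨ht.1, hvt⟩
  · simp only [Finset.mem_filter, Finset.mem_univ, true_and]
    omega

theorem multiplicity_anti (P : BranchingProgram n) {s e : ℕ} (hse : s ≤ e) (v : Fin n) :
    P.multiplicity e v ≤ P.multiplicity s v := by
  refine Finset.card_le_card fun u hu => ?_
  simp only [Finset.mem_filter, Finset.mem_univ, true_and] at hu ⊢
  exact ⟨hse.trans hu.1, hu.2⟩

theorem notMem_queriedBetween_of_multiplicity_eq_zero {P : BranchingProgram n} {s : ℕ}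
    {v : Fin n} (hv : P.multiplicity s v = 0) (e : ℕ) : v ∉ P.queriedBetween s e := by
  intro h
  obtain ⟨t, ht, hvt⟩ := mem_queriedBetween.1 h
  rw [multiplicity, Finset.card_eq_zero, Finset.filter_eq_empty_iff] at hv
  exact hv (Finset.mem_univ t) ⟨ht.1, hvt⟩

theorem sum_multiplicity_le (P : BranchingProgram n) :
    ∑ v, P.multiplicity 0 v ≤ P.width * P.length := by
  have h := Finset.sum_card_bipartiteAbove_eq_sum_card_bipartiteBelow
    (s := (Finset.univ : Finset (Fin n))) (t := (Finset.univ : Finset (Fin P.length)))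
    (fun v t => v ∈ P.queried t)
  calc ∑ v, P.multiplicity 0 v
      = ∑ t : Fin P.length, (P.queried t).card := by
        simpa [multiplicity, Finset.bipartiteAbove, Finset.bipartiteBelow] using h
    _ ≤ ∑ _t : Fin P.length, P.width := Finset.sum_le_sum fun t _ => P.card_queried_le t
    _ = P.width * P.length := by simp [mul_comm]

/-! ### Alternating blocks and the meander lemma -/

/-- The levels from `s` on split into `r` consecutive blocks, in each of which no variable of `S`
or no variable of `T` is queried. -/
inductive Alternates (P : BranchingProgram n) (S T : Finset (Fin n)) : ℕ → ℕ → Prop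
  | nil : Alternates P S T 0 P.length
  | cons {r s e : ℕ} (hse : s ≤ e)
      (h : Disjoint S (P.queriedBetween s e) ∨ Disjoint T (P.queriedBetween s e))
      (ht : Alternates P S T r e) : Alternates P S T (r + 1) s

theorem Alternates.add {P : BranchingProgram n} {S T : Finset (Fin n)} {r s : ℕ}
    (h : P.Alternates S T r s) (k : ℕ) : P.Alternates S T (r + k) s := by
  induction k with
  | zero => exact h
  | succ k ih =>
    exact .cons le_rfl (Or.inl (by rw [queriedBetween_self]; exact Finset.disjoint_empty_right _)) ih

/-- At the first level at which `h` variables of `A` or `h` variables of `B` have been queried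
since level `s`, fewer than `h + width` variables of the other set have been queried. -/
theorem exists_first_card_queriedBetween_ge (P : BranchingProgram n) {s h : ℕ} (hs : s ≤ P.length) (hh : 0 < h)
    {A B : Finset (Fin n)}
    (hex : ∃ d, h ≤ (A ∩ P.queriedBetween s (s + d)).card ∨
      h ≤ (B ∩ P.queriedBetween s (s + d)).card) :
    ∃ e, s ≤ e ∧ e ≤ P.length ∧
      ((h ≤ (A ∩ P.queriedBetween s e).card ∧ (B ∩ P.queriedBetween s e).card < h + P.width) ∨
       (h ≤ (B ∩ P.queriedBetween s e).card ∧
          (A ∩ P.queriedBetween s e).card < h + P.width)) := by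
  classical
  let d := Nat.find hex
  have hd : h ≤ (A ∩ P.queriedBetween s (s + d)).card ∨
      h ≤ (B ∩ P.queriedBetween s (s + d)).card := Nat.find_spec hex
  have hd0 : d ≠ 0 := by
    intro h0
    rw [h0] at hd
    simp only [Nat.add_zero, queriedBetween_self, Finset.inter_empty, Finset.card_empty] at hd
    omega
  obtain ⟨d', hd'⟩ := Nat.exists_eq_succ_of_ne_zero hd0
  have hmin := Nat.find_min hex (m := d') (by change d' < d; omega)
  have hA := P.card_queriedBetween_succ_inter_le s (s + d') A
  have hB := P.card_queriedBetween_succ_inter_le s (s + d') B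
  have hle : s + d ≤ P.length := by
    have hd : d ≤ P.length - s := by
      refine Nat.find_min' hex ?_
      have hsub : P.queriedBetween s (s + d) ⊆ P.queriedBetween s (s + (P.length - s)) :=
        fun v hv => by
          obtain ⟨t, ht, hvt⟩ := mem_queriedBetween.1 hv
          exact mem_queriedBetween.2 ⟨t, ⟨ht.1, by omega⟩, hvt⟩
      exact hd.imp (fun h => h.trans (Finset.card_le_card (Finset.inter_subset_inter_left hsub)))
        (fun h => h.trans (Finset.card_le_card (Finset.inter_subset_inter_left hsub)))
    omega
  refine ⟨s + d, Nat.le_add_right _ _, hle, ?_⟩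
  rw [hd', Nat.succ_eq_add_one, ← Nat.add_assoc] at hd ⊢
  push Not at hmin
  omega

/-- The Alon–Maass meander lemma: if the variables of `A` and `B` have multiplicities at most `i`
and `j`, then large subsets of `A` and `B` alternate at most `i + j` times. -/
theorem exists_alternates (P : BranchingProgram n) (m : ℕ) (hm : 0 < m) (r : ℕ) :
    ∀ (i j s : ℕ) (A B : Finset (Fin n)), i + j = r → s ≤ P.length →
      (∀ v ∈ A, P.multiplicity s v ≤ i) → (∀ v ∈ B, P.multiplicity s v ≤ j) →
      2 ^ r * (m + P.width) ≤ A.card + P.width → 2 ^ r * (m + P.width) ≤ B.card + P.width →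
      ∃ S ⊆ A, ∃ T ⊆ B, S.card = m ∧ T.card = m ∧ P.Alternates S T (r + 1) s := by
  induction r with
  | zero =>
    intro i j s A B hij hs hA hB hAc hBc
    obtain ⟨S, hSA, hS⟩ := Finset.exists_subset_card_eq (s := A) (n := m) (by omega)
    obtain ⟨T, hTB, hT⟩ := Finset.exists_subset_card_eq (s := B) (n := m) (by omega)
    refine ⟨S, hSA, T, hTB, hS, hT, .cons hs (Or.inl ?_) .nil⟩
    refine Finset.disjoint_left.2 fun v hv => ?_
    exact notMem_queriedBetween_of_multiplicity_eq_zero (by have := hA v (hSA hv); omega) _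
  | succ r ih =>
    intro i j s A B hij hs hA hB hAc hBc
    have hpow : m + P.width ≤ 2 ^ r * (m + P.width) :=
      Nat.le_mul_of_pos_left _ (by positivity)
    -- The threshold `h` is the size that the induction hypothesis requires. The summand `width` in
    -- the size bounds absorbs the overshoot of a single level.
    obtain ⟨h, hh⟩ : ∃ h, 2 ^ r * (m + P.width) = h + P.width :=
      ⟨2 ^ r * (m + P.width) - P.width, by omega⟩
    have hpow' : 2 ^ (r + 1) * (m + P.width) = 2 * (h + P.width) := by rw [← hh]; ring
    rw [hpow'] at hAc hBc
    have hcA := fun e => Finset.card_sdiff_add_card_inter A (P.queriedBetween s e)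
    have hcB := fun e => Finset.card_sdiff_add_card_inter B (P.queriedBetween s e)
    by_cases hex : ∃ d, h ≤ (A ∩ P.queriedBetween s (s + d)).card ∨
      h ≤ (B ∩ P.queriedBetween s (s + d)).card
    · obtain ⟨e, hse, hel, he⟩ := P.exists_first_card_queriedBetween_ge hs (by omega) hex
      have hcA := hcA e
      have hcB := hcB e
      have hin : ∀ (C : Finset (Fin n)) (l : ℕ), (∀ v ∈ C, P.multiplicity s v ≤ l) →
          0 < (C ∩ P.queriedBetween s e).card →
          0 < l ∧ ∀ v ∈ C ∩ P.queriedBetween s e, P.multiplicity e v ≤ l - 1 := by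
        intro C l hC hne
        have hlt : ∀ v ∈ C ∩ P.queriedBetween s e, P.multiplicity e v < l := fun v hv =>
          (multiplicity_lt_of_mem hse (Finset.mem_inter.1 hv).2).trans_le
            (hC v (Finset.mem_inter.1 hv).1)
        obtain ⟨v, hv⟩ := Finset.card_pos.1 hne
        exact ⟨Nat.zero_lt_of_lt (hlt v hv), fun v hv => Nat.le_sub_one_of_lt (hlt v hv)⟩
      have hout : ∀ (C : Finset (Fin n)) (l : ℕ), (∀ v ∈ C, P.multiplicity s v ≤ l) →
          ∀ v ∈ C \ P.queriedBetween s e, P.multiplicity e v ≤ l := fun C l hC v hv =>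
        (P.multiplicity_anti hse v).trans (hC v (Finset.mem_sdiff.1 hv).1)
      have hdisj : ∀ C D : Finset (Fin n), D ⊆ C \ P.queriedBetween s e →
          Disjoint D (P.queriedBetween s e) := fun C D hD =>
        Finset.disjoint_of_subset_left hD Finset.sdiff_disjoint
      -- Keep the queried part of the set that reached `h`, whose multiplicity bound drops by one,
      -- and the unqueried part of the other, which the block avoids.
      rcases he with ⟨hA', hB'⟩ | ⟨hB', hA'⟩
      · obtain ⟨hi, hi'⟩ := hin A i hA (by omega)
        obtain ⟨S, hSA, T, hTB, hS, hT, halt⟩ := ih (i - 1) j e _ _ (by omega) hel hi'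
          (hout B j hB) (by omega) (by omega)
        exact ⟨S, hSA.trans Finset.inter_subset_left, T, hTB.trans Finset.sdiff_subset, hS, hT,
          .cons hse (Or.inr (hdisj B T hTB)) halt⟩
      · obtain ⟨hj, hj'⟩ := hin B j hB (by omega)
        obtain ⟨S, hSA, T, hTB, hS, hT, halt⟩ := ih i (j - 1) e _ _ (by omega) hel
          (hout A i hA) hj' (by omega) (by omega)
        exact ⟨S, hSA.trans Finset.sdiff_subset, T, hTB.trans Finset.inter_subset_left, hS, hT,
          .cons hse (Or.inl (hdisj A S hSA)) halt⟩
    -- The threshold is never reached, so enough of `A` is never queried again: one block suffices,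
    -- padded by empty ones.
    · push Not at hex
      have := (hex (P.length - s)).1
      rw [Nat.add_sub_cancel' hs] at this
      have hcA := hcA P.length
      obtain ⟨S, hSA, hS⟩ := Finset.exists_subset_card_eq
        (s := A \ P.queriedBetween s P.length) (n := m) (by omega)
      obtain ⟨T, hTB, hT⟩ := Finset.exists_subset_card_eq (s := B) (n := m) (by omega)
      have hd : P.Alternates S T 1 s := .cons hs (Or.inl (Finset.disjoint_left.2 fun v hv =>
        (Finset.mem_sdiff.1 (hSA hv)).2)) .nil
      refine ⟨S, hSA.trans Finset.sdiff_subset, T, hTB, hS, hT, ?_⟩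
      rw [Nat.add_comm]
      exact hd.add _

/-! ### Pigeonhole over the blocks -/

/-- Two inputs that agree on all variables queried between two levels lead from
the same vertex to the same vertex. -/
theorem state_eq_of_agree (P : BranchingProgram n) {x y : Fin n → Bool} {s e : ℕ} (hse : s ≤ e)
    (hst : P.state x s = P.state y s) (hxy : ∀ v ∈ P.queriedBetween s e, x v = y v) :
    P.state x e = P.state y e := by
  induction e, hse using Nat.le_induction with
  | base => exact hst
  | succ e hse ih =>
    have ih := ih fun v hv => hxy v (by
      obtain ⟨t, ht, hvt⟩ := mem_queriedBetween.1 hv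
      exact mem_queriedBetween.2 ⟨t, ⟨ht.1, by omega⟩, hvt⟩)
    simp only [state]
    split
    · next h =>
      have hv := hxy (P.query ⟨e, h⟩ (P.state y e)) (mem_queriedBetween.2
        ⟨⟨e, h⟩, ⟨hse, Nat.lt_succ_self e⟩, Finset.mem_image_of_mem _ (Finset.mem_univ _)⟩)
      rw [ih, hv]
    · exact ih

/-- A rectangle of more than `width ^ r` rows and columns on whose entries a program
with `r` alternations behaves alike at level `s` contains a nontrivial subrectangle
on which all outcomes coincide. -/
theorem Alternates.exists_ne {P : BranchingProgram n} {S T : Finset (Fin n)} {r s : ℕ}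
    (h : P.Alternates S T r s) {ι : Type*} (x : ι → ι → Fin n → Bool)
    (hS : ∀ i i' j, ∀ v ∉ S, x i j v = x i' j v)
    (hT : ∀ i j j', ∀ v ∉ T, x i j v = x i j' v)
    (I : Finset ι) (hI : P.width ^ r < I.card)
    (hst : ∀ i ∈ I, ∀ j ∈ I, ∀ i' ∈ I, ∀ j' ∈ I, P.state (x i j) s = P.state (x i' j') s) :
    ∃ i j, i ≠ j ∧ P.eval (x i i) = P.eval (x i j) ∧ P.eval (x i i) = P.eval (x j i) := by
  induction h generalizing I with
  | nil =>
    obtain ⟨i, hi, j, hj, hij⟩ := Finset.one_lt_card.1 (by simpa using hI)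
    exact ⟨i, j, hij, congrArg P.output (hst i hi i hi i hi j hj),
      congrArg P.output (hst i hi i hi j hj i hi)⟩
  | @cons r s e hse hd _ ih =>
    classical
    obtain ⟨i₀, hi₀⟩ : I.Nonempty := Finset.card_pos.1 (by omega)
    obtain hd | hd := hd
    -- A block avoiding `S` ends in a state that depends on the column only. Rows and columns are
    -- both restricted to the most convenient class, so the rectangle keeps its diagonal.
    · obtain ⟨u, -, hu⟩ := Finset.exists_lt_card_fiber_of_mul_lt_card_of_maps_to
        (s := I) (t := Finset.univ) (f := fun j => P.state (x i₀ j) e) (n := P.width ^ r)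
        (fun _ _ => Finset.mem_univ _) (by simpa [pow_succ, mul_comm] using hI)
      have key : ∀ i ∈ I, ∀ j ∈ I, P.state (x i j) e = P.state (x i₀ j) e := fun i hi j hj =>
        P.state_eq_of_agree hse (hst i hi j hj i₀ hi₀ j hj) fun v hv =>
          hS _ _ _ v (Finset.disjoint_right.1 hd hv)
      refine ih _ hu fun i hi j hj i' hi' j' hj' => ?_
      simp only [Finset.mem_filter] at hi hj hi' hj'
      rw [key i hi.1 j hj.1, key i' hi'.1 j' hj'.1, hj.2, hj'.2]
    · obtain ⟨u, -, hu⟩ := Finset.exists_lt_card_fiber_of_mul_lt_card_of_maps_to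
        (s := I) (t := Finset.univ) (f := fun i => P.state (x i i₀) e) (n := P.width ^ r)
        (fun _ _ => Finset.mem_univ _) (by simpa [pow_succ, mul_comm] using hI)
      have key : ∀ i ∈ I, ∀ j ∈ I, P.state (x i j) e = P.state (x i i₀) e := fun i hi j hj =>
        P.state_eq_of_agree hse (hst i hi j hj i hi i₀ hi₀) fun v hv =>
          hT _ _ _ v (Finset.disjoint_right.1 hd hv)
      refine ih _ hu fun i hi j hj i' hi' j' hj' => ?_
      simp only [Finset.mem_filter] at hi hj hi' hj'
      rw [key i hi.1 j hj.1, key i' hi'.1 j' hj'.1, hi.2, hi'.2]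

end BranchingProgram

/-! ### The fooling set for majority -/

theorem maj_eq_true_iff {n : ℕ} (x : Fin n → Bool) :
    maj n x = true ↔ n ≤ 2 * hammingWeight x := by
  rw [maj, decide_eq_true_iff, div_le_iff₀ (by norm_num)]
  constructor
  · intro h
    have : (n : ℚ) ≤ ((2 * hammingWeight x : ℕ) : ℚ) := by push_cast; linarith
    exact_mod_cast this
  · intro h
    have : (n : ℚ) ≤ ((2 * hammingWeight x : ℕ) : ℚ) := by exact_mod_cast h
    push_cast at this
    linarith

theorem hammingWeight_mem_finset {n : ℕ} (U : Finset (Fin n)) :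
    hammingWeight (fun v => decide (v ∈ U)) = U.card := by
  simp [hammingWeight]

namespace BranchingProgram

variable {n : ℕ}

theorem exists_subsets_card_eq {α : Type*} (S : Finset α) :
    ∃ f : ℕ → Finset α, ∀ i, f i ⊆ S ∧ (i ≤ S.card → (f i).card = i) := by
  have h : ∀ i, ∃ U ⊆ S, i ≤ S.card → U.card = i := by
    intro i
    by_cases hi : i ≤ S.card
    · obtain ⟨U, hU, hc⟩ := Finset.exists_subset_card_eq hi
      exact ⟨U, hU, fun _ => hc⟩
    · exact ⟨∅, Finset.empty_subset _, fun h => absurd h hi⟩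
  choose f hf hf' using h
  exact ⟨f, fun i => ⟨hf i, hf' i⟩⟩

theorem Computes.card_lt_of_alternates {P : BranchingProgram n} (hP : P.Computes (maj n))
    {S T : Finset (Fin n)} (hST : Disjoint S T) {m r : ℕ} (hS : S.card = m) (hT : T.card = m)
    (h : P.Alternates S T r 0) : m < P.width ^ r := by
  by_contra! hlt
  have hcard : 2 * m ≤ n := by
    have := Finset.card_le_univ (S ∪ T)
    rw [Finset.card_union_of_disjoint hST, Fintype.card_fin] at this
    omega
  obtain ⟨R, hR, hRc⟩ := Finset.exists_subset_card_eq (s := (S ∪ T)ᶜ) (n := (n + 1) / 2 - m) (by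
    rw [Finset.card_compl, Finset.card_union_of_disjoint hST, Fintype.card_fin]
    omega)
  obtain ⟨f, hf⟩ := exists_subsets_card_eq S
  obtain ⟨g, hg⟩ := exists_subsets_card_eq T
  have hRS : ∀ v ∈ R, v ∉ S ∧ v ∉ T := fun v hv => by simpa using hR hv
  let U : Fin (m + 1) → Fin (m + 1) → Finset (Fin n) := fun i j => (f i ∪ g (m - j)) ∪ R
  have hU : ∀ i j, (U i j).card = i + (m - j) + ((n + 1) / 2 - m) := by
    intro i j
    rw [Finset.card_union_of_disjoint, Finset.card_union_of_disjoint, (hf i).2 (by omega),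
      (hg _).2 (by omega), hRc]
    · exact Finset.disjoint_of_subset_left (hf _).1 (Finset.disjoint_of_subset_right (hg _).1 hST)
    · refine Finset.disjoint_right.2 fun v hv hv' => ?_
      rcases Finset.mem_union.1 hv' with h' | h'
      · exact (hRS v hv).1 ((hf _).1 h')
      · exact (hRS v hv).2 ((hg _).1 h')
  obtain ⟨i, j, hij, h₁, h₂⟩ := h.exists_ne (fun i j v => decide (v ∈ U i j))
    (fun i i' j v hv => by
      have h₁ : v ∉ f i := fun h => hv ((hf _).1 h)
      have h₂ : v ∉ f i' := fun h => hv ((hf _).1 h)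
      simp [U, h₁, h₂])
    (fun i j j' v hv => by
      have h₁ : v ∉ g (m - j) := fun h => hv ((hg _).1 h)
      have h₂ : v ∉ g (m - j') := fun h => hv ((hg _).1 h)
      simp [U, h₁, h₂])
    Finset.univ (by simpa using Nat.lt_succ_of_le hlt) (fun _ _ _ _ _ _ _ _ => rfl)
  -- The weight of `U i j` is `⌈n/2⌉ + i - j`: the diagonal is accepted, but one of `(i, j)` and
  -- `(j, i)` is rejected.
  rw [hP, hP, Bool.eq_iff_iff, maj_eq_true_iff, maj_eq_true_iff, hammingWeight_mem_finset,
    hammingWeight_mem_finset, hU, hU] at h₁ h₂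
  have : (i : ℕ) ≠ j := fun h => hij (Fin.ext h)
  omega

theorem Computes.length_pos {P : BranchingProgram n} (hP : P.Computes (maj n)) (hn : 0 < n) :
    0 < P.length := by
  by_contra! h0
  have h : ∀ x y, P.eval x = P.eval y := by
    intro x y
    rw [eval, eval, Nat.le_zero.1 h0]
    rfl
  have h := h (fun v => decide (v ∈ (Finset.univ : Finset (Fin n))))
    (fun v => decide (v ∈ (∅ : Finset (Fin n))))
  rw [hP, hP, Bool.eq_iff_iff, maj_eq_true_iff, maj_eq_true_iff, hammingWeight_mem_finset,
    hammingWeight_mem_finset, Finset.card_univ, Fintype.card_fin, Finset.card_empty] at h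
  omega

/-! ### The quantitative bound -/

/-- Markov's inequality for the multiplicities of the variables. -/
theorem lt_two_mul_card_multiplicity_le (P : BranchingProgram n) {k : ℕ}
    (hk : 2 * (P.width * P.length) < (k + 1) * n) :
    n < 2 * (Finset.univ.filter (fun v => P.multiplicity 0 v ≤ k)).card := by
  have hsplit := Finset.card_filter_add_card_filter_not (s := (Finset.univ : Finset (Fin n)))
    (fun v => P.multiplicity 0 v ≤ k)
  rw [Finset.card_univ, Fintype.card_fin] at hsplit
  have hbad : (Finset.univ.filter (fun v => ¬ P.multiplicity 0 v ≤ k)).card * (k + 1) ≤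
      P.width * P.length := by
    refine le_trans ?_ P.sum_multiplicity_le
    refine le_trans ?_ (Finset.sum_le_sum_of_subset (Finset.filter_subset
      (fun v => ¬ P.multiplicity 0 v ≤ k) _))
    rw [← smul_eq_mul]
    refine Finset.card_nsmul_le_sum _ _ _ fun v hv => ?_
    have := (Finset.mem_filter.1 hv).2
    omega
  have : 2 * (Finset.univ.filter (fun v => ¬ P.multiplicity 0 v ≤ k)).card < n := by
    refine lt_of_not_ge fun h => ?_
    have := Nat.mul_le_mul_left (k + 1) h
    linarith
  omega

theorem Computes.lt_pow {P : BranchingProgram n} (hP : P.Computes (maj n)) {k : ℕ}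
    (hk : 2 * (P.width * P.length) < (k + 1) * n) : n < (8 * P.width ^ 2) ^ (k + 1) := by
  have hw : 0 < P.width := Fin.pos P.start
  -- The factor 4 pays for Markov and for halving `G`.
  have hM : 4 * (2 ^ (k + k) * (P.width ^ (k + k + 1) + P.width)) ≤ (8 * P.width ^ 2) ^ (k + 1) := by
    have h₁ : P.width ≤ P.width ^ (k + k + 1) := Nat.le_self_pow (by omega) _
    calc 4 * (2 ^ (k + k) * (P.width ^ (k + k + 1) + P.width))
        ≤ 4 * (2 ^ (k + k) * (P.width ^ (k + k + 1) + P.width ^ (k + k + 1))) := by gcongr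
      _ = 8 * 4 ^ k * P.width ^ (k + k + 1) := by
        rw [← two_mul k, pow_mul]; ring
      _ ≤ 8 * 8 ^ k * P.width ^ (2 * (k + 1)) := by
        gcongr
        · norm_num
        · omega
      _ = (8 * P.width ^ 2) ^ (k + 1) := by rw [mul_pow, ← pow_mul]; ring
  refine lt_of_lt_of_le ?_ hM
  by_contra! hn
  have hG := P.lt_two_mul_card_multiplicity_le hk
  set G := Finset.univ.filter (fun v => P.multiplicity 0 v ≤ k) with hGdef
  obtain ⟨A, hAG, hA⟩ := Finset.exists_subset_card_eq (s := G) (n := G.card / 2) (by omega)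
  have hB : (G \ A).card = G.card - G.card / 2 := by rw [Finset.card_sdiff_of_subset hAG, hA]
  have hmult : ∀ v ∈ G, P.multiplicity 0 v ≤ k := fun v hv => (Finset.mem_filter.1 hv).2
  obtain ⟨S, hSA, T, hTB, hS, hT, halt⟩ := P.exists_alternates (P.width ^ (k + k + 1))
    (by positivity) (k + k) k k 0 A (G \ A) rfl (Nat.zero_le _) (fun v hv => hmult v (hAG hv))
    (fun v hv => hmult v (Finset.mem_sdiff.1 hv).1) (by omega) (by omega)
  have hST : Disjoint S T := Finset.disjoint_of_subset_left hSA
    (Finset.disjoint_of_subset_right hTB Finset.disjoint_sdiff)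
  exact lt_irrefl _ (hP.card_lt_of_alternates hST hS hT halt)

theorem Computes.mul_log_le {P : BranchingProgram n} (hP : P.Computes (maj n)) :
    (n : ℝ) * Real.log n ≤
      (8 * (P.width : ℝ) ^ 2 + 4 * P.width) * Real.log (8 * (P.width : ℝ) ^ 2) * P.length := by
  obtain rfl | hn := Nat.eq_zero_or_pos n
  · have hw : 1 ≤ P.width := Fin.pos P.start
    have hw' : (1 : ℝ) ≤ P.width := by exact_mod_cast hw
    have := Real.log_nonneg (x := 8 * (P.width : ℝ) ^ 2) (by nlinarith)
    simp only [Nat.cast_zero, zero_mul]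
    positivity
  have hw : 1 ≤ P.width := Fin.pos P.start
  have hw' : (1 : ℝ) ≤ P.width := by exact_mod_cast hw
  have hn' : (0 : ℝ) < n := by exact_mod_cast hn
  have hL : (1 : ℝ) ≤ P.length := by exact_mod_cast hP.length_pos hn
  have hlog := Real.log_nonneg (x := 8 * (P.width : ℝ) ^ 2) (by nlinarith)
  set k := 2 * (P.width * P.length) / n with hk
  have hpow : n < (8 * P.width ^ 2) ^ (k + 1) := hP.lt_pow (by
    rw [mul_comm (k + 1)]
    exact Nat.lt_mul_div_succ _ hn)
  have hlogn : Real.log n ≤ (k + 1) * Real.log (8 * (P.width : ℝ) ^ 2) := by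
    have h : (n : ℝ) ≤ (8 * (P.width : ℝ) ^ 2) ^ (k + 1) := by exact_mod_cast hpow.le
    have := Real.log_le_log hn' h
    rw [Real.log_pow] at this
    exact_mod_cast this
  have hmul : (n : ℝ) * (k + 1) ≤ (8 * (P.width : ℝ) ^ 2 + 4 * P.width) * P.length := by
    -- For `k = 0` the bound on `n` itself suffices, as `length ≥ 1`; otherwise `k + 1 ≤ 2 * k`.
    obtain h0 | h0 := Nat.eq_zero_or_pos k
    · rw [h0, zero_add, pow_one] at hpow
      have h : (n : ℝ) ≤ 8 * (P.width : ℝ) ^ 2 := by exact_mod_cast hpow.le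
      rw [h0]
      push_cast
      nlinarith
    · have h : n * k ≤ 2 * (P.width * P.length) := Nat.mul_div_le _ _
      have h : (n : ℝ) * k ≤ 2 * (P.width * P.length) := by exact_mod_cast h
      have h1 : (1 : ℝ) ≤ k := by exact_mod_cast h0
      have : 0 ≤ 8 * (P.width : ℝ) ^ 2 * P.length := by positivity
      nlinarith
  calc (n : ℝ) * Real.log n ≤ n * ((k + 1) * Real.log (8 * (P.width : ℝ) ^ 2)) := by gcongr
    _ = n * (k + 1) * Real.log (8 * (P.width : ℝ) ^ 2) := by ring
    _ ≤ (8 * (P.width : ℝ) ^ 2 + 4 * P.width) * P.length * Real.log (8 * (P.width : ℝ) ^ 2) := by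
      gcongr
    _ = _ := by ring

end BranchingProgram

theorem mainTheorem7 :
    ∀ w : ℕ, ∃ c : ℝ, 0 < c ∧
      ∀ (n : ℕ) (P : BranchingProgram n), P.width ≤ w → P.Computes (maj n) →
        c * ((n : ℝ) * Real.log (n : ℝ)) ≤ (P.length : ℝ) := by
  intro w
  -- Using `w + 1` keeps the logarithm positive even for `w = 0`.
  have hw : (1 : ℝ) ≤ (w : ℝ) + 1 := by have := Nat.cast_nonneg (α := ℝ) w; linarith
  have hlog := Real.log_pos (x := 8 * ((w : ℝ) + 1) ^ 2) (by nlinarith)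
  have hC : 0 < (8 * ((w : ℝ) + 1) ^ 2 + 4 * (w + 1)) * Real.log (8 * ((w : ℝ) + 1) ^ 2) := by
    positivity
  refine ⟨_, inv_pos.2 hC, fun n P hPw hP => ?_⟩
  rw [inv_mul_le_iff₀ hC]
  have hpos : (0 : ℝ) < P.width := by exact_mod_cast Fin.pos P.start
  have hle : (P.width : ℝ) ≤ w + 1 := by exact_mod_cast hPw.trans (Nat.le_succ w)
  have hone : (1 : ℝ) ≤ P.width := by exact_mod_cast Fin.pos P.start
  have := Real.log_nonneg (x := 8 * (P.width : ℝ) ^ 2) (by nlinarith)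
  refine hP.mul_log_le.trans ?_
  gcongr
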